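/- Let $\mathbb{P}$ be the space of all Borel probability measures on $\mathbb{R}$, with the Borel $\sigma$-algebra of the topology of weak convergence. For a finite Borel measure $\alpha$ on $\mathbb{R}$ with $\alpha(\mathbb{R})>0$, let $\mathcal{D}_\alpha$ be the law on $\mathbb{P}$ of the Dirichlet process with parameter $\alpha$, that is, the probability measure on $\mathbb{P}$ such that for every finite measurable partition $C_1,\dots,C_n$ of $\mathbb{R}$ the random vector $(\varphi(C_1),\dots,\varphi(C_n))$, with $\varphi$ drawn from $\mathcal{D}_\alpha$, has the Dirichlet distribution with parameters $(\alpha(C_1),\dots,\alpha(C_n))$. (The Dirichlet distribution with parameters $b_1,\dots,b_n\ge 0$, not all zero, is the law of $(Z_i/\sum_j Z_j)_{1\le i\le n}$ for independent $Z_i$ having the gamma distribution with shape $b_i$ and scale $1$, where $Z_i=0$ if $b_i=0$.) For $a>0$ let $$\mathbb{F}_a=\Big\{\alpha \text{ a Borel measure on }\mathbb{R}:\ \alpha(\mathbb{R})=a,\ \int_{\mathbb{R}}\log(1+|x|)\,\alpha(dx)<\infty\Big\}.$$ Theorem 8. Let $a>0$ and $\alpha\in\mathbb{F}_a$. Then $\int|x|\,\varphi(dx)<\infty$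 for $\mathcal{D}_\alpha$-almost every $\varphi$, so that the law $\mu_\alpha$ under $\mathcal{D}_\alpha$ of the mean $\varphi\mapsto\int x\,\varphi(dx)$ is well defined, and $\mu_\alpha$ is symmetric (invariant under $x\mapsto -x$) if and only if $\alpha$ is symmetric (invariant under $x\mapsto -x$). -/

import Mathlib

open MeasureTheory ProbabilityTheory

namespace DirichletProcess

noncomputable section

/-- The gamma distribution with shape `b ≥ 0` and scale `1`; for shape `0` it is the unit mass
at `0`. -/
def gammaLaw (b : ℝ) : Measure ℝ :=
  if 0 < b then gammaMeasure b 1 else Measure.dirac 0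

/-- The Dirichlet distribution on `ℝ^ι` with parameters `b i ≥ 0`, not all zero: the law of
`(Z i / ∑ j, Z j)_i`, where the `Z i` are independent and `Z i` has the gamma distribution with
shape `b i` and scale `1`. Coordinates with parameter `0` are identically `0`. -/
def dirichletDistribution {ι : Type*} [Fintype ι] (b : ι → ℝ) : Measure (ι → ℝ) :=
  (Measure.pi fun i => gammaLaw (b i)).map fun z i => z i / ∑ j, z j

/-- `IsDirichletLaw α D`: the law `D` on the space of probability measures on `ℝ` is the
functional Dirichlet distribution with parameter `α`. That is, for every finite measurable
partition `C` of `ℝ`, the vector `(φ (C i))_i` has, when `φ` is drawn from `D`, the Dirichlet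
distribution with parameters `(α (C i))_i`. Cells of a partition may be empty. The σ-algebra on
`ProbabilityMeasure ℝ` is the one generated by the evaluations at measurable sets, which is the
Borel σ-algebra of the topology of weak convergence. -/
def IsDirichletLaw (α : Measure ℝ) (D : Measure (ProbabilityMeasure ℝ)) : Prop :=
  IsProbabilityMeasure D ∧
    ∀ (n : ℕ) (C : Fin n → Set ℝ), (∀ i, MeasurableSet (C i)) →
      Pairwise (fun i j => Disjoint (C i) (C j)) → (⋃ i, C i) = Set.univ →
        D.map (fun (φ : ProbabilityMeasure ℝ) i => (φ : Measure ℝ).real (C i)) =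
          dirichletDistribution fun i => α.real (C i)

/-- The set of Borel measures on `ℝ` of total mass `a` with `∫ log (1 + |x|) dα < ∞`. -/
def logFiniteMeasures (a : ℝ) : Set (Measure ℝ) :=
  {α | α Set.univ = ENNReal.ofReal a ∧
    ∫⁻ x, ENNReal.ofReal (Real.log (1 + |x|)) ∂α < ⊤}

/-- The mean of a probability measure on `ℝ` (meaningful when its first absolute moment is
finite). -/
def mean (φ : ProbabilityMeasure ℝ) : ℝ :=
  ∫ x, x ∂(φ : Measure ℝ)

theorem measurable_mean : Measurable mean := by
  let κ : Kernel (ProbabilityMeasure ℝ) ℝ := ⟨fun φ => (φ : Measure ℝ), measurable_subtype_coe⟩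
  have : IsMarkovKernel κ := ⟨fun φ => φ.2⟩
  exact (StronglyMeasurable.integral_kernel (κ := κ) (f := fun x : ℝ => x)
    stronglyMeasurable_id).measurable

/-- The law of the mean of a random probability measure whose law is `D`. -/
def meanLaw (D : Measure (ProbabilityMeasure ℝ)) : Measure ℝ :=
  D.map mean

end

end DirichletProcess

namespace DirichletProcess

open Filter Topology
open scoped ENNReal

/-! ### Uniqueness for Laplace transforms -/

section Laplace

/-! Let `γ` be gamma distributed with shape `a` and independent of `φ`. Then `γ φ` takes independent
gamma values on disjoint sets, which gives the Cifarelli–Regazzini identity `E exp (-γ ∫ f dφ) = exp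
(-∫ log (1 + f) dα)`. For simple `f` with `re f ≥ 0` it reduces to a fact about finitely many gamma
variables: their sum is independent of their ratios. The reason is that tilting by `exp (t * sum)`
only rescales the variables and so leaves the ratios alone (`map_sum_normalized_pi_gammaLaw`).
Log-integrability of `α` dominates `log (1 + f)` when `f` grows linearly, so limits of simple
functions are available.

Letting `f` increase to `r |x|` bounds `P (∫ |x| dφ < ∞)` below by `exp (-∫ log (1 + r |x|) dα)`,
which tends to `1` as `r → 0`. Hence the mean exists almost surely (`ae_integrable_id`).

Taking `f = i t x` gives the characteristic function of `γ` times the mean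
(`integral_exp_I_mul_mean`). If the mean is symmetric, this is even in `t`, so `exp (∫ (log (1 +
itx) - log (1 - itx)) dα) = 1`. Differentiating in `t` removes the ambiguity of the logarithm and
yields `∫ x / (s² + x²) dα = 0` for all `s > 0`. That integral is the Laplace transform of `u ↦ ∫
sin (u x) dα`, so the characteristic function of `α` is real and `α` is symmetric. Conversely, if
`α` is symmetric, reflecting a partition does not change the Dirichlet law of its cells. -/

theorem integrable_exp_mul_of_lintegral_ne_top {μ : Measure ℝ} {t : ℝ}
    (h : ∫⁻ x, ENNReal.ofReal (Real.exp (t * x)) ∂μ ≠ ⊤) :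
    Integrable (fun x => Real.exp (t * x)) μ :=
  (lintegral_ofReal_ne_top_iff_integrable (by fun_prop)
    (ae_of_all _ fun _ => (Real.exp_pos _).le)).1 h

/-- If the exponential moments of order `t < 1` of `μ` are finite, the complex moment generating
function is determined on the half plane `re z < 1` by its values on the real axis. -/
theorem complexMGF_id_eqOn_of_eq_ofReal {μ : Measure ℝ} {F : ℂ → ℂ}
    (hfin : ∀ t < 1, Integrable (fun x => Real.exp (t * x)) μ)
    (hF : AnalyticOnNhd ℂ F {z | z.re < 1})
    (h : ∀ t : ℝ, t < 1 → complexMGF id μ t = F t) :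
    Set.EqOn (complexMGF id μ) F {z | z.re < 1} := by
  have hsub : Set.Iio (1 : ℝ) ⊆ interior (integrableExpSet id μ) :=
    interior_maximal (fun t ht => hfin t ht) isOpen_Iio
  have hM : AnalyticOnNhd ℂ (complexMGF id μ) {z | z.re < 1} :=
    analyticOnNhd_complexMGF.mono fun z hz => hsub hz
  have hconv : Convex ℝ {z : ℂ | z.re < 1} := convex_halfSpace_re_lt 1
  refine hM.eqOn_of_preconnected_of_frequently_eq hF hconv.isPreconnected
    (z₀ := ((0 : ℝ) : ℂ)) (by simp) ?_
  have hev : ∃ᶠ x : ℝ in 𝓝[≠] 0, complexMGF id μ x = F x := by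
    refine Eventually.frequently ?_
    filter_upwards [nhdsWithin_le_nhds (Iio_mem_nhds (zero_lt_one : (0 : ℝ) < 1))] with x hx
    exact h x hx
  have htend : Tendsto (fun x : ℝ => (x : ℂ)) (𝓝[≠] 0) (𝓝[≠] ((0 : ℝ) : ℂ)) := by
    refine tendsto_nhdsWithin_of_tendsto_nhds_of_eventually_within _ ?_ ?_
    · exact (Complex.continuous_ofReal.tendsto 0).mono_left nhdsWithin_le_nhds
    · filter_upwards [self_mem_nhdsWithin] with x hx
      simpa using hx
  exact htend.frequently hev

/-- Both complex moment generating functions are analytic on `re z < 1`. This half plane contains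
the imaginary axis, so agreement on the reals carries over to the characteristic functions. -/
theorem ext_of_lintegral_exp {μ ν : Measure ℝ} [IsFiniteMeasure μ] [IsFiniteMeasure ν]
    (hfin : ∀ t < 1, ∫⁻ x, ENNReal.ofReal (Real.exp (t * x)) ∂μ ≠ ⊤)
    (h : ∀ t < 1, ∫⁻ x, ENNReal.ofReal (Real.exp (t * x)) ∂μ =
      ∫⁻ x, ENNReal.ofReal (Real.exp (t * x)) ∂ν) : μ = ν := by
  have hν : ∀ t < 1, Integrable (fun x => Real.exp (t * x)) ν := fun t ht =>
    integrable_exp_mul_of_lintegral_ne_top (h t ht ▸ hfin t ht)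
  have hsub : Set.Iio (1 : ℝ) ⊆ interior (integrableExpSet id ν) :=
    interior_maximal (fun t ht => hν t ht) isOpen_Iio
  have key := complexMGF_id_eqOn_of_eq_ofReal (μ := μ) (F := complexMGF id ν)
    (fun t ht => integrable_exp_mul_of_lintegral_ne_top (hfin t ht))
    (analyticOnNhd_complexMGF.mono fun z hz => hsub hz) (fun t ht => by
      rw [complexMGF_ofReal, complexMGF_ofReal, mgf, mgf,
        integral_eq_lintegral_of_nonneg_ae (ae_of_all _ fun _ => (Real.exp_pos _).le)
          (by fun_prop),
        integral_eq_lintegral_of_nonneg_ae (ae_of_all _ fun _ => (Real.exp_pos _).le)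
          (by fun_prop)]
      simp only [id, h t ht])
  refine Measure.ext_of_charFun (funext fun t => ?_)
  rw [← complexMGF_id_mul_I, ← complexMGF_id_mul_I]
  exact key (by simp)

end Laplace

/-! ### Gamma distributions: tilting and complex transform -/

section Gamma

instance isProbabilityMeasure_gammaLaw (b : ℝ) : IsProbabilityMeasure (gammaLaw b) := by
  unfold gammaLaw
  split_ifs with h
  · exact isProbabilityMeasure_gammaMeasure h one_pos
  · infer_instance

theorem gammaLaw_of_pos {b : ℝ} (hb : 0 < b) : gammaLaw b = gammaMeasure b 1 := if_pos hb

theorem ae_pos_gammaLaw {b : ℝ} (hb : 0 < b) : ∀ᵐ x ∂gammaLaw b, 0 < x := by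
  have h0 : ∀ᵐ x ∂gammaLaw b, x ≠ 0 := by
    rw [gammaLaw_of_pos hb, gammaMeasure]
    exact (withDensity_absolutelyContinuous _ _).ae_le (Measure.ae_ne volume 0)
  have h1 : ∀ᵐ x ∂gammaLaw b, 0 ≤ x := by
    have hm : gammaLaw b (Set.Iio 0) = 0 := by
      rw [gammaLaw_of_pos hb, gammaMeasure, withDensity_apply _ measurableSet_Iio]
      exact lintegral_gammaPDF_of_nonpos le_rfl
    rw [ae_iff]
    simpa [Set.Iio] using hm
  filter_upwards [h0, h1] with x hx hx'
  exact lt_of_le_of_ne hx' (Ne.symm hx)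

theorem gammaPDF_mul_exp (b t x : ℝ) (hb : 0 < b) (ht : t < 1) :
    gammaPDF b 1 x * ENNReal.ofReal (Real.exp (t * x)) =
      ENNReal.ofReal ((1 - t) ^ (-b)) *
        (ENNReal.ofReal (1 - t) * gammaPDF b 1 ((1 - t) * x)) := by
  have hr : 0 < 1 - t := by linarith
  have hG := Real.Gamma_pos_of_pos hb
  rcases lt_or_ge x 0 with hx | hx
  · rw [gammaPDF_of_neg hx, gammaPDF_of_neg (mul_neg_of_pos_of_neg hr hx)]
    simp
  · rw [gammaPDF_of_nonneg hx, gammaPDF_of_nonneg (by positivity),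
      ← ENNReal.ofReal_mul (by positivity), ← ENNReal.ofReal_mul (by positivity),
      ← ENNReal.ofReal_mul (by positivity)]
    congr 1
    rw [Real.mul_rpow hr.le hx, Real.rpow_sub_one hr.ne', Real.rpow_neg hr.le,
      show -(1 * ((1 - t) * x)) = -(1 * x) + t * x by ring, Real.exp_add]
    have : (1 - t) ^ b ≠ 0 := (Real.rpow_pos_of_pos hr b).ne'
    field_simp

/-- Exponential tilting of the gamma distribution is rescaling. -/
theorem gammaLaw_withDensity_exp {b t : ℝ} (hb : 0 ≤ b) (ht : t < 1) :
    (gammaLaw b).withDensity (fun x => ENNReal.ofReal (Real.exp (t * x))) =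
      ENNReal.ofReal ((1 - t) ^ (-b)) • (gammaLaw b).map (fun x => x / (1 - t)) := by
  have hr : 0 < 1 - t := by linarith
  rcases hb.eq_or_lt with rfl | hb
  · simp only [gammaLaw, lt_irrefl, if_false]
    rw [Measure.map_dirac' (by fun_prop)]
    ext s hs
    rw [withDensity_apply _ hs]
    rw [← lintegral_indicator hs, lintegral_dirac]
    by_cases h : (0 : ℝ) ∈ s <;> simp [h]
  · rw [gammaLaw_of_pos hb, gammaMeasure]
    have hm : Measurable (gammaPDF b 1) := (measurable_gammaPDFReal b 1).ennreal_ofReal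
    ext s hs
    have hs' : MeasurableSet ((fun x : ℝ => x / (1 - t)) ⁻¹' s) :=
      (by fun_prop : Measurable fun x : ℝ => x / (1 - t)) hs
    have hm2 : Measurable (((fun x : ℝ => x / (1 - t)) ⁻¹' s).indicator (gammaPDF b 1)) :=
      hm.indicator hs'
    have hscale : ∀ F : ℝ → ℝ≥0∞, Measurable F →
        ∫⁻ x, F x = ENNReal.ofReal (1 - t) * ∫⁻ x, F ((1 - t) * x) := fun F hF => by
      conv_lhs => rw [← Real.smul_map_volume_mul_left hr.ne', lintegral_smul_measure,
        lintegral_map hF (by fun_prop), abs_of_pos hr]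
      rfl
    rw [withDensity_apply _ hs, restrict_withDensity hs,
      lintegral_withDensity_eq_lintegral_mul _ hm (by fun_prop), Measure.smul_apply,
      Measure.map_apply (by fun_prop) hs, withDensity_apply _ hs', ← lintegral_indicator hs',
      hscale _ hm2]
    simp only [Pi.mul_apply, smul_eq_mul]
    have hm3 := hm2.comp (measurable_const_mul (1 - t))
    simp only [Function.comp_def] at hm3
    rw [← lintegral_indicator hs, ← lintegral_const_mul _ (by fun_prop),
      ← lintegral_const_mul _ (by fun_prop)]
    refine lintegral_congr fun x => ?_
    by_cases hx : x ∈ s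
    · rw [Set.indicator_of_mem hx, gammaPDF_mul_exp b t x hb ht, Set.indicator_of_mem]
      simpa [mul_div_cancel_left₀ _ hr.ne'] using hx
    · rw [Set.indicator_of_notMem hx, Set.indicator_of_notMem]
      · simp
      · simpa [mul_div_cancel_left₀ _ hr.ne'] using hx

theorem lintegral_exp_gammaLaw {b t : ℝ} (hb : 0 ≤ b) (ht : t < 1) :
    ∫⁻ x, ENNReal.ofReal (Real.exp (t * x)) ∂gammaLaw b = ENNReal.ofReal ((1 - t) ^ (-b)) := by
  have h := congrArg (fun m : Measure ℝ => m Set.univ) (gammaLaw_withDensity_exp hb ht)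
  simpa [withDensity_apply, Measure.map_apply (by fun_prop : Measurable fun x : ℝ => x / (1 - t))
    MeasurableSet.univ] using h

/-- Analytic continuation from real arguments: for `re z < 1` the number `1 - z` stays in the right
half plane, where the principal logarithm is analytic. -/
theorem complexMGF_gammaLaw {b : ℝ} (hb : 0 ≤ b) {z : ℂ} (hz : z.re < 1) :
    complexMGF id (gammaLaw b) z = Complex.exp (-(b * Complex.log (1 - z))) := by
  refine complexMGF_id_eqOn_of_eq_ofReal (F := fun z => Complex.exp (-(b * Complex.log (1 - z))))
    (fun t ht => integrable_exp_mul_of_lintegral_ne_top ?_) ?_ (fun t ht => ?_) hz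
  · rw [lintegral_exp_gammaLaw hb ht]
    exact ENNReal.ofReal_ne_top
  · intro w hw
    have hw' : 1 - w ∈ Complex.slitPlane := by
      left
      simpa using hw
    fun_prop (disch := assumption)
  · have hr : 0 < 1 - t := by linarith
    rw [complexMGF_ofReal, mgf,
      integral_eq_lintegral_of_nonneg_ae (ae_of_all _ fun _ => (Real.exp_pos _).le) (by fun_prop)]
    simp only [id]
    rw [lintegral_exp_gammaLaw hb ht, ENNReal.toReal_ofReal (by positivity),
      Real.rpow_def_of_pos hr, ← Complex.ofReal_one, ← Complex.ofReal_sub,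
      ← Complex.ofReal_log hr.le]
    push_cast
    congr 1
    ring

end Gamma

/-! ### Independence of the sum and the ratios of gamma variables -/

section Dirichlet

variable {ι : Type*} [Fintype ι]

/-- The tilt factors over the coordinates, and each factor rescales its coordinate by the same `1 -
t`. -/
theorem pi_gammaLaw_withDensity_exp {b : ι → ℝ} (hb : ∀ i, 0 ≤ b i) {t : ℝ} (ht : t < 1) :
    (Measure.pi fun i => gammaLaw (b i)).withDensity
        (fun z => ENNReal.ofReal (Real.exp (t * ∑ i, z i))) =
      ENNReal.ofReal ((1 - t) ^ (-∑ i, b i)) •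
        (Measure.pi fun i => gammaLaw (b i)).map (fun z i => z i / (1 - t)) := by
  have hr : 0 < 1 - t := by linarith
  set m : ι → Measure ℝ := fun i =>
    (gammaLaw (b i)).withDensity (fun x => ENNReal.ofReal (Real.exp (t * x))) with hm
  have hfin : ∀ i, IsFiniteMeasure (m i) := fun i => by
    refine isFiniteMeasure_withDensity ?_
    rw [lintegral_exp_gammaLaw (hb i) ht]
    exact ENNReal.ofReal_ne_top
  -- Both sides are compared on boxes with the product of the tilted marginals.
  trans Measure.pi m
  · symm
    refine Measure.pi_eq fun s hs => ?_
    have hbox : MeasurableSet (Set.univ.pi s) := MeasurableSet.univ_pi hs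
    rw [withDensity_apply _ hbox, ← lintegral_indicator hbox]
    have hX : ∀ i, Measurable ((s i).indicator fun x => ENNReal.ofReal (Real.exp (t * x))) :=
      fun i => Measurable.indicator (by fun_prop) (hs i)
    have hind := iIndepFun_pi (μ := fun i => gammaLaw (b i)) (fun i => (hX i).aemeasurable)
    have hprod := lintegral_prod_eq_prod_lintegral_of_indepFun Finset.univ _ hind
      (fun i => (hX i).comp (measurable_pi_apply i))
    have hcoord : ∀ i, ∫⁻ z, (s i).indicator (fun x => ENNReal.ofReal (Real.exp (t * x))) (z i)
        ∂(Measure.pi fun i => gammaLaw (b i)) = m i (s i) := fun i => by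
      rw [hm, withDensity_apply _ (hs i), ← lintegral_indicator (hs i)]
      exact (measurePreserving_eval (fun i => gammaLaw (b i)) i).lintegral_comp (hX i)
    rw [← Finset.prod_congr rfl fun i _ => hcoord i, ← hprod]
    refine lintegral_congr fun z => ?_
    by_cases hz : z ∈ Set.univ.pi s
    · rw [Set.indicator_of_mem hz, Finset.mul_sum, Real.exp_sum,
        ENNReal.ofReal_prod_of_nonneg fun i _ => (Real.exp_pos _).le]
      exact Finset.prod_congr rfl fun i _ => (Set.indicator_of_mem (hz i trivial)
        fun x => ENNReal.ofReal (Real.exp (t * x))).symm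
    · rw [Set.indicator_of_notMem hz]
      obtain ⟨i, hi⟩ : ∃ i, z i ∉ s i := by simpa [Set.mem_univ_pi] using hz
      exact (Finset.prod_eq_zero (Finset.mem_univ i) (Set.indicator_of_notMem hi _)).symm
  · refine Measure.pi_eq fun s hs => ?_
    have hbox : MeasurableSet (Set.univ.pi s) := MeasurableSet.univ_pi hs
    rw [Measure.smul_apply, Measure.map_apply (by fun_prop) hbox]
    have hpre : (fun (z : ι → ℝ) i => z i / (1 - t)) ⁻¹' Set.univ.pi s =
        Set.univ.pi fun i => (fun x => x / (1 - t)) ⁻¹' s i := by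
      ext z; simp
    rw [hpre, Measure.pi_pi, ← Finset.sum_neg_distrib, Real.rpow_sum_of_pos hr,
      ENNReal.ofReal_prod_of_nonneg (fun i _ => (Real.rpow_pos_of_pos hr _).le), smul_eq_mul,
      ← Finset.prod_mul_distrib]
    refine Finset.prod_congr rfl fun i _ => ?_
    rw [hm]
    simp only
    rw [gammaLaw_withDensity_exp (hb i) ht, Measure.smul_apply, smul_eq_mul,
      Measure.map_apply (by fun_prop) (hs i)]

/-- The sum of independent gamma variables is gamma distributed and independent of the vector of
normalized variables, which has the Dirichlet distribution. -/
theorem map_sum_normalized_pi_gammaLaw {b : ι → ℝ} (hb : ∀ i, 0 ≤ b i) :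
    (Measure.pi fun i => gammaLaw (b i)).map
        (fun z => (∑ i, z i, fun i => z i / ∑ j, z j)) =
      (gammaLaw (∑ i, b i)).prod (dirichletDistribution b) := by
  set P := Measure.pi fun i => gammaLaw (b i) with hP
  set T : (ι → ℝ) → ℝ := fun z => ∑ i, z i with hT
  set R : (ι → ℝ) → ι → ℝ := fun z i => z i / ∑ j, z j with hR
  have hTm : Measurable T := by fun_prop
  have hRm : Measurable R := by fun_prop
  have hD : dirichletDistribution b = P.map R := rfl
  have : IsProbabilityMeasure (dirichletDistribution b) :=
    hD ▸ Measure.isProbabilityMeasure_map hRm.aemeasurable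
  symm
  refine Measure.prod_eq fun s A hs hA => ?_
  have hsum : 0 ≤ ∑ i, b i := Finset.sum_nonneg fun i _ => hb i
  -- On an event depending only on the ratios, tilting by the sum is a rescaling that preserves the
  -- event. The Laplace transform of the sum there is thus the gamma one times the probability of
  -- the event.
  have key : (P.restrict (R ⁻¹' A)).map T = P (R ⁻¹' A) • gammaLaw (∑ i, b i) := by
    have hLap : ∀ t < 1, ∫⁻ x, ENNReal.ofReal (Real.exp (t * x)) ∂(P.restrict (R ⁻¹' A)).map T =
        ENNReal.ofReal ((1 - t) ^ (-∑ i, b i)) * P (R ⁻¹' A) := fun t ht => by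
      have hr : 0 < 1 - t := by linarith
      rw [lintegral_map (by fun_prop) hTm, ← withDensity_apply _ (hRm hA),
        pi_gammaLaw_withDensity_exp hb ht, Measure.smul_apply,
        Measure.map_apply (by fun_prop) (hRm hA), smul_eq_mul]
      congr 2
      ext z
      have : R (fun i => z i / (1 - t)) = R z := by
        ext i
        simp only [hR, ← Finset.sum_div]
        exact div_div_div_cancel_right₀ hr.ne' _ _
      simp only [Set.mem_preimage, this]
    have : IsFiniteMeasure (P (R ⁻¹' A) • gammaLaw (∑ i, b i)) :=
      Measure.smul_finite _ (measure_ne_top _ _)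
    refine ext_of_lintegral_exp (fun t ht => ?_) (fun t ht => ?_)
    · rw [hLap t ht]
      exact ENNReal.mul_ne_top ENNReal.ofReal_ne_top (measure_ne_top _ _)
    · rw [hLap t ht, lintegral_smul_measure, lintegral_exp_gammaLaw hsum ht, smul_eq_mul, mul_comm]
  have h2 := congrArg (fun m : Measure ℝ => m s) key
  simp only [Measure.smul_apply, smul_eq_mul] at h2
  rw [Measure.map_apply hTm hs, Measure.restrict_apply (hTm hs)] at h2
  rw [Measure.map_apply (hTm.prodMk hRm) (hs.prod hA), hD, Measure.map_apply hRm hA, mul_comm,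
    ← h2]
  rfl

/-- The Laplace transform of a Dirichlet vector multiplied by an independent gamma variable. -/
theorem integral_exp_mul_sum_dirichlet {b : ι → ℝ} (hb : ∀ i, 0 ≤ b i) (ha : 0 < ∑ i, b i)
    {c : ι → ℂ} (hc : ∀ i, 0 ≤ (c i).re) :
    ∫ p, Complex.exp (-(p.1 * ∑ i, p.2 i * c i))
        ∂((gammaLaw (∑ i, b i)).prod (dirichletDistribution b)) =
      Complex.exp (-∑ i, b i * Complex.log (1 + c i)) := by
  -- The sum must be nonzero to cancel against the denominators of the ratios.
  have hT : ∀ᵐ z ∂(Measure.pi fun i => gammaLaw (b i)), ∑ i, z i ≠ 0 := by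
    have h1 : (Measure.pi fun i => gammaLaw (b i)).map (fun z => ∑ i, z i) =
        gammaLaw (∑ i, b i) := by
      have h2 := congrArg (fun m => m.map Prod.fst) (map_sum_normalized_pi_gammaLaw hb)
      have : IsProbabilityMeasure (dirichletDistribution b) :=
        Measure.isProbabilityMeasure_map (by fun_prop)
      simpa [Measure.map_map measurable_fst (by fun_prop : Measurable
        fun z : ι → ℝ => (∑ i, z i, fun i => z i / ∑ j, z j)), Function.comp_def] using h2
    have h3 := ae_pos_gammaLaw ha
    rw [← h1] at h3
    filter_upwards [ae_of_ae_map (by fun_prop) h3] with z hz using hz.ne'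
  rw [← map_sum_normalized_pi_gammaLaw hb, integral_map (by fun_prop) (by fun_prop)]
  have h4 : ∀ᵐ z ∂(Measure.pi fun i => gammaLaw (b i)),
      Complex.exp (-(((∑ i, z i : ℝ) : ℂ) * ∑ i, ((z i / ∑ j, z j : ℝ) : ℂ) * c i)) =
        ∏ i, Complex.exp (-c i * z i) := by
    filter_upwards [hT] with z hz
    have hz' : ((∑ i, z i : ℝ) : ℂ) ≠ 0 := by exact_mod_cast hz
    rw [← Complex.exp_sum, Finset.mul_sum, ← Finset.sum_neg_distrib]
    congr 1
    refine Finset.sum_congr rfl fun i _ => ?_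
    rw [Complex.ofReal_div]
    field_simp
  rw [integral_congr_ae h4,
    integral_fintype_prod_eq_prod (fun i (x : ℝ) => Complex.exp (-c i * x)),
    ← Finset.sum_neg_distrib, Complex.exp_sum]
  refine Finset.prod_congr rfl fun i _ => ?_
  have := complexMGF_gammaLaw (hb i) (z := -c i) (by have := hc i; simp; linarith)
  rw [sub_neg_eq_add] at this
  exact this

end Dirichlet

/-! ### Simple functions and finite partitions -/

section Partition

/-- The level sets of a simple function, as a finite measurable partition. -/
theorem exists_partition_of_simpleFunc {E : Type*} (f : SimpleFunc ℝ E) :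
    ∃ (n : ℕ) (C : Fin n → Set ℝ) (c : Fin n → E), (∀ i, MeasurableSet (C i)) ∧
      Pairwise (fun i j => Disjoint (C i) (C j)) ∧ (⋃ i, C i) = Set.univ ∧
      (∀ i, ∃ x, f x = c i) ∧
      ∀ (μ : Measure ℝ) [IsFiniteMeasure μ] (g : E → ℂ),
        ∫ x, g (f x) ∂μ = ∑ i, (μ.real (C i) : ℂ) * g (c i) := by
  classical
  set e := f.range.equivFin
  refine ⟨f.range.card, fun i => f ⁻¹' {(e.symm i : E)}, fun i => e.symm i,
    fun i => f.measurableSet_fiber _, ?_, ?_, fun i => ?_, fun μ _ g => ?_⟩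
  · intro i j hij
    refine Disjoint.preimage _ (Set.disjoint_singleton.2 fun h => hij ?_)
    exact e.symm.injective (Subtype.ext h)
  · refine Set.eq_univ_of_forall fun x => Set.mem_iUnion.2 ⟨e ⟨f x, f.mem_range_self x⟩, ?_⟩
    simp
  · exact SimpleFunc.mem_range.1 (e.symm i).2
  · have hpt : ∀ x, g (f x) =
        ∑ i, (f ⁻¹' {(e.symm i : E)}).indicator (fun _ => g (e.symm i)) x := fun x => by
      rw [Finset.sum_eq_single (e ⟨f x, f.mem_range_self x⟩)]
      · simp
      · intro i _ hi
        refine Set.indicator_of_notMem (fun hx => hi ?_) _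
        rw [← e.apply_symm_apply i]
        exact congrArg e (Subtype.ext (Eq.symm hx))
      · simp
    simp_rw [hpt]
    rw [integral_finsetSum _ fun i _ => (integrable_const _).indicator (f.measurableSet_fiber _)]
    refine Finset.sum_congr rfl fun i _ => ?_
    rw [integral_indicator_const _ (f.measurableSet_fiber _)]
    rfl

end Partition

variable {a : ℝ} {α : Measure ℝ} {D : Measure (ProbabilityMeasure ℝ)}

theorem isFiniteMeasure_of_mem_logFiniteMeasures (hα : α ∈ logFiniteMeasures a) :
    IsFiniteMeasure α :=
  ⟨by rw [hα.1]; exact ENNReal.ofReal_lt_top⟩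

theorem measurable_real_apply {s : Set ℝ} (hs : MeasurableSet s) :
    Measurable fun φ : ProbabilityMeasure ℝ => (φ : Measure ℝ).real s :=
  ((Measure.measurable_coe hs).comp measurable_subtype_coe).ennreal_toReal

theorem measurable_lintegral_probabilityMeasure {f : ℝ → ℝ≥0∞} (hf : Measurable f) :
    Measurable fun φ : ProbabilityMeasure ℝ => ∫⁻ x, f x ∂(φ : Measure ℝ) :=
  (Measure.measurable_lintegral hf).comp measurable_subtype_coe

theorem measurable_integral_simpleFunc (f : SimpleFunc ℝ ℂ) :
    Measurable fun φ : ProbabilityMeasure ℝ => ∫ x, f x ∂(φ : Measure ℝ) := by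
  obtain ⟨n, C, c, hC, -, -, -, h⟩ := exists_partition_of_simpleFunc f
  have : (fun φ : ProbabilityMeasure ℝ => ∫ x, f x ∂(φ : Measure ℝ)) =
      fun φ : ProbabilityMeasure ℝ => ∑ i, ((φ : Measure ℝ).real (C i) : ℂ) * c i :=
    funext fun φ => h φ id
  rw [this]
  exact Finset.measurable_sum _ fun i _ =>
    (Complex.measurable_ofReal.comp (measurable_real_apply (hC i))).mul_const _

/-- The Cifarelli–Regazzini identity for simple functions. -/
theorem integral_exp_mul_integral_simpleFunc (ha : 0 < a) (hα : α Set.univ = ENNReal.ofReal a)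
    (hD : IsDirichletLaw α D) (f : SimpleFunc ℝ ℂ) (hf : ∀ x, 0 ≤ (f x).re) :
    ∫ p, Complex.exp (-(p.1 * ∫ x, f x ∂(p.2 : Measure ℝ))) ∂((gammaLaw a).prod D) =
      Complex.exp (-∫ x, Complex.log (1 + f x) ∂α) := by
  have hfin : IsFiniteMeasure α := ⟨by rw [hα]; exact ENNReal.ofReal_lt_top⟩
  have hDp := hD.1
  obtain ⟨n, C, c, hC, hdisj, huniv, hrange, h⟩ := exists_partition_of_simpleFunc f
  have hsum : ∑ i, α.real (C i) = a := by
    have h1 : ((∑ i, α.real (C i) : ℝ) : ℂ) = α.real Set.univ := by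
      have := h α fun _ => 1
      simpa using this.symm
    have h2 : α.real Set.univ = a := by
      rw [measureReal_def, hα, ENNReal.toReal_ofReal ha.le]
    exact_mod_cast h1.trans (congrArg _ h2)
  have hev : Measurable fun (φ : ProbabilityMeasure ℝ) i => (φ : Measure ℝ).real (C i) :=
    measurable_pi_lambda _ fun i => measurable_real_apply (hC i)
  have hmap : ((gammaLaw a).prod D).map
      (Prod.map id fun (φ : ProbabilityMeasure ℝ) i => (φ : Measure ℝ).real (C i)) =
      (gammaLaw (∑ i, α.real (C i))).prod (dirichletDistribution fun i => α.real (C i)) := by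
    rw [hsum, ← hD.2 n C hC hdisj huniv, ← Measure.map_prod_map _ _ measurable_id hev,
      Measure.map_id]
  have key := integral_exp_mul_sum_dirichlet (b := fun i => α.real (C i)) (c := c)
    (fun i => measureReal_nonneg) (hsum.symm ▸ ha) (fun i => by
      obtain ⟨x, hx⟩ := hrange i
      exact hx ▸ hf x)
  rw [← hmap, integral_map (measurable_id.prodMap hev).aemeasurable
    (Measurable.aestronglyMeasurable (by fun_prop))] at key
  rw [h α fun z => Complex.log (1 + z), ← key]
  refine integral_congr_ae (ae_of_all _ fun p => ?_)
  simp only [Prod.map_fst, Prod.map_snd, id]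
  have hp : ∫ x, f x ∂(p.2 : Measure ℝ) = _ := h p.2 id
  rw [hp]
  rfl

/-- Integrals of a simple function and of its reflection have the same law. -/
theorem integral_comp_integral_simpleFunc_neg [IsFiniteMeasure α] [α.IsNegInvariant]
    (hD : IsDirichletLaw α D) (f : SimpleFunc ℝ ℂ) {F : ℂ → ℂ} (hF : Measurable F) :
    ∫ φ, F (∫ x, f (-x) ∂(φ : Measure ℝ)) ∂D = ∫ φ, F (∫ x, f x ∂(φ : Measure ℝ)) ∂D := by
  obtain ⟨n, C, c, hC, hdisj, huniv, hrange, h⟩ := exists_partition_of_simpleFunc f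
  have hC' : ∀ i, MeasurableSet (Neg.neg ⁻¹' C i) := fun i => measurable_neg (hC i)
  have hneg : ∀ φ : ProbabilityMeasure ℝ, ∫ x, f (-x) ∂(φ : Measure ℝ) =
      ∑ i, ((φ : Measure ℝ).real (Neg.neg ⁻¹' C i) : ℂ) * c i := fun φ => by
    have hmeas : AEStronglyMeasurable f (Measure.map Neg.neg (φ : Measure ℝ)) :=
      f.aestronglyMeasurable
    have := h ((φ : Measure ℝ).map Neg.neg) id
    simp only [id] at this
    rw [integral_map measurable_neg.aemeasurable hmeas] at this
    rw [this]
    refine Finset.sum_congr rfl fun i _ => ?_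
    rw [measureReal_def, measureReal_def, Measure.map_apply measurable_neg (hC i)]
  have hpos : ∀ φ : ProbabilityMeasure ℝ, ∫ x, f x ∂(φ : Measure ℝ) =
      ∑ i, ((φ : Measure ℝ).real (C i) : ℂ) * c i := fun φ => h φ id
  have hev : Measurable fun (φ : ProbabilityMeasure ℝ) i => (φ : Measure ℝ).real (C i) :=
    measurable_pi_lambda _ fun i => measurable_real_apply (hC i)
  have hev' : Measurable fun (φ : ProbabilityMeasure ℝ) i =>
      (φ : Measure ℝ).real (Neg.neg ⁻¹' C i) :=
    measurable_pi_lambda _ fun i => measurable_real_apply (hC' i)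
  -- The reflected cells have the same `α`-masses, hence the same Dirichlet parameters.
  have hlaw : D.map (fun (φ : ProbabilityMeasure ℝ) i => (φ : Measure ℝ).real (Neg.neg ⁻¹' C i)) =
      D.map (fun (φ : ProbabilityMeasure ℝ) i => (φ : Measure ℝ).real (C i)) := by
    rw [hD.2 n C hC hdisj huniv, hD.2 n _ hC' (fun i j hij => (hdisj hij).preimage _) (by
      rw [← Set.preimage_iUnion, huniv, Set.preimage_univ])]
    congr 1
    ext i
    rw [measureReal_def, measureReal_def]
    congr 1
    conv_rhs => rw [← Measure.neg_eq_self α]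
    exact (Measure.map_apply measurable_neg (hC i)).symm
  have hG : Measurable fun v : Fin n → ℝ => F (∑ i, (v i : ℂ) * c i) :=
    hF.comp (by fun_prop)
  have h1 := integral_map (μ := D) hev.aemeasurable hG.aestronglyMeasurable
  have h2 := integral_map (μ := D) hev'.aemeasurable hG.aestronglyMeasurable
  rw [hlaw, h1] at h2
  simp only [hneg, hpos]
  exact h2.symm

/-! ### Domination by the logarithmic moment -/

theorem integrable_log_one_add_abs (hα : α ∈ logFiniteMeasures a) :
    Integrable (fun x => Real.log (1 + |x|)) α :=
  (lintegral_ofReal_ne_top_iff_integrable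
    (Measurable.aestronglyMeasurable (by fun_prop))
    (ae_of_all _ fun x => Real.log_nonneg (by linarith [abs_nonneg x]))).1 hα.2.ne

/-- Since `re z ≥ 0` forces `‖1 + z‖ ≥ 1`, the real part of the logarithm lies between `0` and `log
((1 + r) (1 + |x|))`; the imaginary part is at most `π` in modulus. -/
theorem norm_log_one_add_le {z : ℂ} {r x : ℝ} (hz : 0 ≤ z.re) (hr : 0 ≤ r) (h : ‖z‖ ≤ r * |x|) :
    ‖Complex.log (1 + z)‖ ≤ Real.log (1 + r) + Real.log (1 + |x|) + Real.pi := by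
  have h1 : 1 ≤ ‖1 + z‖ := by
    refine le_trans ?_ (Complex.re_le_norm _)
    simpa using hz
  have h2 : ‖1 + z‖ ≤ (1 + r) * (1 + |x|) := by
    refine (norm_add_le _ _).trans ?_
    rw [norm_one]
    nlinarith [abs_nonneg x]
  calc ‖Complex.log (1 + z)‖
      ≤ |(Complex.log (1 + z)).re| + |(Complex.log (1 + z)).im| :=
        Complex.norm_le_abs_re_add_abs_im _
    _ ≤ Real.log ((1 + r) * (1 + |x|)) + Real.pi := by
        rw [Complex.log_re, abs_of_nonneg (Real.log_nonneg h1), Complex.log_im]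
        gcongr
        exact Complex.abs_arg_le_pi _
    _ = _ := by
        rw [Real.log_mul (by positivity) (by positivity)]

theorem integrable_log_bound (hα : α ∈ logFiniteMeasures a) (r : ℝ) :
    Integrable (fun x => Real.log (1 + r) + Real.log (1 + |x|) + Real.pi) α := by
  have := isFiniteMeasure_of_mem_logFiniteMeasures hα
  exact ((integrable_const _).add (integrable_log_one_add_abs hα)).add (integrable_const _)

theorem one_add_mem_slitPlane {z : ℂ} (hz : 0 ≤ z.re) : 1 + z ∈ Complex.slitPlane := by
  left
  simp only [Complex.add_re, Complex.one_re]
  linarith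

/-- Dominated convergence for `∫ log (1 + f) dα`. -/
theorem tendsto_integral_log_one_add (hα : α ∈ logFiniteMeasures a) {f : ℕ → ℝ → ℂ} {g : ℝ → ℂ}
    {r : ℝ} (hr : 0 ≤ r) (hfm : ∀ n, Measurable (f n)) (hf : ∀ n x, 0 ≤ (f n x).re)
    (hg : ∀ x, 0 ≤ (g x).re) (hbound : ∀ n x, ‖f n x‖ ≤ r * |x|)
    (hlim : ∀ x, Tendsto (fun n => f n x) atTop (𝓝 (g x))) :
    Tendsto (fun n => ∫ x, Complex.log (1 + f n x) ∂α) atTop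
      (𝓝 (∫ x, Complex.log (1 + g x) ∂α)) := by
  refine tendsto_integral_of_dominated_convergence _
    (fun n => Measurable.aestronglyMeasurable (by have := hfm n; fun_prop))
    (integrable_log_bound hα r)
    (fun n => ae_of_all _ fun x => norm_log_one_add_le (hf n x) hr (hbound n x))
    (ae_of_all _ fun x => ?_)
  exact ((hlim x).const_add 1).clog (one_add_mem_slitPlane (hg x))

/-- The approximation is increasing, so monotone convergence makes the integrals diverge when the
first absolute moment is infinite; the last clause detects such measures. -/
theorem exists_simpleFunc_approx_abs : ∃ g : ℕ → SimpleFunc ℝ ℝ,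
    (∀ n x, 0 ≤ g n x) ∧ (∀ n x, g n x ≤ |x|) ∧
    (∀ x, Tendsto (fun n => g n x) atTop (𝓝 |x|)) ∧
    ∀ μ : Measure ℝ, IsFiniteMeasure μ → ∫⁻ x, ENNReal.ofReal |x| ∂μ = ⊤ →
      Tendsto (fun n => ∫ x, g n x ∂μ) atTop atTop := by
  have hm : Measurable fun x : ℝ => ENNReal.ofReal |x| := by fun_prop
  set h := SimpleFunc.eapprox fun x : ℝ => ENNReal.ofReal |x| with hh
  have hle : ∀ n x, h n x ≤ ENNReal.ofReal |x| := fun n x => by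
    rw [← SimpleFunc.iSup_eapprox_apply hm x]
    exact le_iSup (fun n => h n x) n
  have htop : ∀ n x, h n x ≠ ⊤ := fun n x => ((hle n x).trans_lt ENNReal.ofReal_lt_top).ne
  have hlim : ∀ x, Tendsto (fun n => h n x) atTop (𝓝 (ENNReal.ofReal |x|)) :=
    fun x => SimpleFunc.tendsto_eapprox hm x
  refine ⟨fun n => (h n).map ENNReal.toReal, fun n x => ENNReal.toReal_nonneg, fun n x => ?_,
    fun x => ?_, fun μ _ hμ => ?_⟩
  · exact ENNReal.toReal_le_of_le_ofReal (abs_nonneg x) (hle n x)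
  · have := (ENNReal.tendsto_toReal ENNReal.ofReal_ne_top).comp (hlim x)
    rwa [ENNReal.toReal_ofReal (abs_nonneg x)] at this
  · rw [← ENNReal.tendsto_ofReal_nhds_top, ← hμ]
    have hl := lintegral_tendsto_of_tendsto_of_monotone (μ := μ)
      (fun n => (h n).measurable.aemeasurable)
      (ae_of_all _ fun x i j hij => SimpleFunc.monotone_eapprox _ hij x)
      (ae_of_all _ hlim)
    refine hl.congr fun n => ?_
    rw [ofReal_integral_eq_lintegral_ofReal (SimpleFunc.integrable_of_isFiniteMeasure _)
      (ae_of_all _ fun x => ENNReal.toReal_nonneg)]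
    refine lintegral_congr fun x => ?_
    exact (ENNReal.ofReal_toReal (htop n x)).symm

theorem norm_exp_neg_mul_le_one {s : ℝ} {z : ℂ} (hs : 0 ≤ s) (hz : 0 ≤ z.re) :
    ‖Complex.exp (-(s * z))‖ ≤ 1 := by
  rw [Complex.norm_exp, Real.exp_le_one_iff]
  simp only [Complex.neg_re, Complex.re_ofReal_mul]
  nlinarith [mul_nonneg hs hz]

theorem measurable_exp_neg_mul_integral_simpleFunc (f : SimpleFunc ℝ ℂ) :
    Measurable fun p : ℝ × ProbabilityMeasure ℝ =>
      Complex.exp (-(p.1 * ∫ x, f x ∂(p.2 : Measure ℝ))) := by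
  have : Measurable fun p : ℝ × ProbabilityMeasure ℝ => ∫ x, f x ∂(p.2 : Measure ℝ) :=
    (measurable_integral_simpleFunc f).comp measurable_snd
  fun_prop

theorem ae_prod_pos (ha : 0 < a) [IsProbabilityMeasure D] :
    ∀ᵐ p ∂(gammaLaw a).prod D, 0 < p.1 := by
  refine ae_of_ae_map (f := Prod.fst) (p := fun s : ℝ => 0 < s) measurable_fst.aemeasurable ?_
  rw [Measure.map_fst_prod, measure_univ, one_smul]
  exact ae_pos_gammaLaw ha

/-! ### Almost sure finiteness of the first moment -/

theorem ae_integrable_id (ha : 0 < a) (hα : α ∈ logFiniteMeasures a) (hD : IsDirichletLaw α D) :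
    ∀ᵐ φ : ProbabilityMeasure ℝ ∂D, Integrable (fun x : ℝ => x) (φ : Measure ℝ) := by
  have hDp := hD.1
  set N : Set (ProbabilityMeasure ℝ) := {φ | ∫⁻ x, ENNReal.ofReal |x| ∂(φ : Measure ℝ) = ⊤} with hN
  have hNm : MeasurableSet N :=
    measurable_lintegral_probabilityMeasure (f := fun x => ENNReal.ofReal |x|) (by fun_prop)
      (measurableSet_singleton ⊤)
  set Q := (gammaLaw a).prod D with hQ
  set N' : Set (ℝ × ProbabilityMeasure ℝ) := Prod.snd ⁻¹' N with hN'
  have hN'm : MeasurableSet N' := measurable_snd hNm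
  obtain ⟨g, hg0, hgle, hglim, hgtop⟩ := exists_simpleFunc_approx_abs
  -- The integrands are bounded by `1` and tend to `0` on `N'`, so the limit of their integrals is
  -- at most the mass of the complement of `N'`.
  have hbound : ∀ r : ℝ, 0 < r →
      ‖Complex.exp (-∫ x, Complex.log (1 + ((r * |x| : ℝ) : ℂ)) ∂α)‖ ≤ Q.real N'ᶜ := by
    intro r hr
    set f : ℕ → SimpleFunc ℝ ℂ := fun n => (g n).map fun y => ((r * y : ℝ) : ℂ) with hf
    have hfr : ∀ n x, f n x = ((r * g n x : ℝ) : ℂ) := fun n x => rfl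
    have hre : ∀ n x, 0 ≤ (f n x).re := fun n x => by
      rw [hfr, Complex.ofReal_re]
      exact mul_nonneg hr.le (hg0 n x)
    have hint : ∀ n (φ : ProbabilityMeasure ℝ), ∫ x, f n x ∂(φ : Measure ℝ) =
        ((r * ∫ x, g n x ∂(φ : Measure ℝ) : ℝ) : ℂ) := fun n φ => by
      simp only [hfr]
      rw [integral_complex_ofReal, integral_const_mul]
    have hnn : ∀ n (φ : ProbabilityMeasure ℝ), 0 ≤ ∫ x, g n x ∂(φ : Measure ℝ) :=
      fun n φ => integral_nonneg (hg0 n)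
    set e : ℕ → ℝ × ProbabilityMeasure ℝ → ℂ := fun n p =>
      Complex.exp (-(p.1 * ∫ x, f n x ∂(p.2 : Measure ℝ))) with he
    have hem : ∀ n, Measurable (e n) := fun n => measurable_exp_neg_mul_integral_simpleFunc (f n)
    have hle : ∀ n, ∀ᵐ p ∂Q, ‖e n p‖ ≤ 1 := fun n => by
      filter_upwards [ae_prod_pos (D := D) ha] with p hp
      refine norm_exp_neg_mul_le_one hp.le ?_
      rw [hint, Complex.ofReal_re]
      exact mul_nonneg hr.le (hnn n _)
    have hei : ∀ n, Integrable (e n) Q := fun n =>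
      (integrable_const (1 : ℝ)).mono' (hem n).aestronglyMeasurable (hle n)
    have hzero : Tendsto (fun n => ∫ p in N', e n p ∂Q) atTop (𝓝 0) := by
      have : Tendsto (fun n => ∫ p in N', e n p ∂Q) atTop (𝓝 (∫ p in N', (0 : ℂ) ∂Q)) := by
        refine tendsto_integral_of_dominated_convergence (fun _ => (1 : ℝ))
          (fun n => (hem n).aestronglyMeasurable) (integrable_const _)
          (fun n => ae_restrict_of_ae (hle n)) ?_
        filter_upwards [ae_restrict_of_ae (ae_prod_pos (D := D) ha), ae_restrict_mem hN'm]
          with p hp hpN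
        rw [tendsto_zero_iff_norm_tendsto_zero]
        simp only [he, hint, Complex.norm_exp]
        refine Real.tendsto_exp_atBot.comp ?_
        have h1 := (hgtop p.2 inferInstance hpN).const_mul_atTop (mul_pos hp hr)
        refine (tendsto_neg_atTop_atBot.comp h1).congr fun n => ?_
        simp only [Function.comp, ← Complex.ofReal_mul, Complex.neg_re, Complex.ofReal_re]
        ring
      simpa using this
    have hlim : Tendsto (fun n => ∫ p, e n p ∂Q) atTop
        (𝓝 (Complex.exp (-∫ x, Complex.log (1 + ((r * |x| : ℝ) : ℂ)) ∂α))) := by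
      have h1 := tendsto_integral_log_one_add hα (f := fun n x => f n x)
        (g := fun x => ((r * |x| : ℝ) : ℂ)) hr.le (fun n => (f n).measurable) hre
        (fun x => by rw [Complex.ofReal_re]; positivity)
        (fun n x => by
          rw [hfr, Complex.norm_real, Real.norm_of_nonneg (mul_nonneg hr.le (hg0 n x))]
          exact mul_le_mul_of_nonneg_left (hgle n x) hr.le)
        (fun x => (Complex.continuous_ofReal.tendsto _).comp ((hglim x).const_mul r))
      refine ((Complex.continuous_exp.tendsto _).comp h1.neg).congr fun n => ?_
      exact (integral_exp_mul_integral_simpleFunc ha hα.1 hD (f n) (hre n)).symm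
    have hcompl : Tendsto (fun n => ∫ p in N'ᶜ, e n p ∂Q) atTop
        (𝓝 (Complex.exp (-∫ x, Complex.log (1 + ((r * |x| : ℝ) : ℂ)) ∂α))) := by
      have := hlim.sub hzero
      rw [sub_zero] at this
      refine this.congr fun n => ?_
      rw [← integral_add_compl hN'm (hei n)]
      ring
    refine le_of_tendsto hcompl.norm (Eventually.of_forall fun n => ?_)
    have := norm_setIntegral_le_of_norm_le_const_ae (μ := Q) (s := N'ᶜ) (C := 1)
      (measure_lt_top _ _) (f := e n) (ae_restrict_of_ae (hle n))
    simpa using this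
  -- Here `r = 1 / (k + 1)`, and the lower bound for the mass of the complement tends to `1`.
  have hone : Tendsto (fun k : ℕ => Complex.exp
      (-∫ x, Complex.log (1 + (((1 / ((k : ℝ) + 1)) * |x| : ℝ) : ℂ)) ∂α)) atTop (𝓝 1) := by
    have h1 := tendsto_integral_log_one_add hα
      (f := fun k x => (((1 / ((k : ℝ) + 1)) * |x| : ℝ) : ℂ)) (g := fun _ => 0) zero_le_one
      (fun k => by fun_prop) (fun k x => by rw [Complex.ofReal_re]; positivity)
      (fun x => by simp) (fun k x => by
        rw [Complex.norm_real, Real.norm_of_nonneg (by positivity)]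
        refine mul_le_mul_of_nonneg_right ?_ (abs_nonneg x)
        rw [div_le_one (by positivity)]
        linarith [(Nat.cast_nonneg k : (0 : ℝ) ≤ k)])
      (fun x => by
        have := (tendsto_one_div_add_atTop_nhds_zero_nat (𝕜 := ℝ)).mul_const |x|
        rw [zero_mul] at this
        simpa [Function.comp_def] using (Complex.continuous_ofReal.tendsto _).comp this)
    simpa [Function.comp_def] using (Complex.continuous_exp.tendsto _).comp h1.neg
  have hfull : 1 ≤ Q.real N'ᶜ := by
    have := le_of_tendsto hone.norm (Eventually.of_forall fun k => hbound _ (by positivity))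
    simpa using this
  have hDN : D N = 0 := by
    have h1 : Q.real N' = D.real N := by
      rw [measureReal_def, measureReal_def, hQ, hN', ← Measure.map_apply measurable_snd hNm,
        Measure.map_snd_prod, measure_univ, one_smul]
    rw [probReal_compl_eq_one_sub hN'm, h1] at hfull
    have : D.real N = 0 := le_antisymm (by linarith) measureReal_nonneg
    exact (measureReal_eq_zero_iff).1 this
  have hae : ∀ᵐ φ ∂D, φ ∉ N := by
    rw [ae_iff]
    simpa using hDN
  filter_upwards [hae] with φ hφ
  have h1 : Integrable (fun x : ℝ => |x|) (φ : Measure ℝ) :=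
    (lintegral_ofReal_ne_top_iff_integrable (by fun_prop) (ae_of_all _ fun x => abs_nonneg x)).1 hφ
  exact (integrable_norm_iff (by fun_prop)).1 h1

/-! ### Passage to the mean -/

/-- Simple functions approximating the identity. -/
theorem exists_simpleFunc_approx_id : ∃ g : ℕ → SimpleFunc ℝ ℝ,
    (∀ n x, ‖g n x‖ ≤ 2 * |x|) ∧ ∀ x, Tendsto (fun n => g n x) atTop (𝓝 x) := by
  refine ⟨SimpleFunc.approxOn (fun x => x) measurable_id Set.univ 0 trivial, fun n x => ?_,
    fun x => ?_⟩
  · have := SimpleFunc.norm_approxOn_zero_le (f := fun x : ℝ => x) measurable_id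
      (Set.mem_univ 0) x n
    rw [two_mul]
    simpa using this
  · exact SimpleFunc.tendsto_approxOn (f := fun x : ℝ => x) measurable_id (Set.mem_univ 0) (by simp)

theorem tendsto_integral_simpleFunc_mean {g : ℕ → SimpleFunc ℝ ℝ}
    (hle : ∀ n x, ‖g n x‖ ≤ 2 * |x|) (hlim : ∀ x, Tendsto (fun n => g n x) atTop (𝓝 x))
    {φ : ProbabilityMeasure ℝ} (hφ : Integrable (fun x : ℝ => x) (φ : Measure ℝ)) :
    Tendsto (fun n => ∫ x, g n x ∂(φ : Measure ℝ)) atTop (𝓝 (mean φ)) :=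
  tendsto_integral_of_dominated_convergence _ (fun n => (g n).aestronglyMeasurable)
    (hφ.abs.const_mul 2) (fun n => ae_of_all _ (hle n)) (ae_of_all _ hlim)

/-- The characteristic function of the mean multiplied by an independent gamma variable. -/
theorem integral_exp_I_mul_mean (ha : 0 < a) (hα : α ∈ logFiniteMeasures a)
    (hD : IsDirichletLaw α D) (t : ℝ) :
    ∫ p, Complex.exp (-(p.1 * (((t * mean p.2 : ℝ) : ℂ) * Complex.I))) ∂((gammaLaw a).prod D) =
      Complex.exp (-∫ x, Complex.log (1 + ((t * x : ℝ) : ℂ) * Complex.I) ∂α) := by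
  have hDp := hD.1
  obtain ⟨g, hle, hlim⟩ := exists_simpleFunc_approx_id
  set f : ℕ → SimpleFunc ℝ ℂ := fun n => (g n).map fun y => ((t * y : ℝ) : ℂ) * Complex.I with hf
  have hfr : ∀ n x, f n x = ((t * g n x : ℝ) : ℂ) * Complex.I := fun n x => rfl
  have hre0 : ∀ y : ℝ, ((y : ℂ) * Complex.I).re = 0 := fun y => by simp
  have hint : ∀ n (φ : ProbabilityMeasure ℝ), ∫ x, f n x ∂(φ : Measure ℝ) =
      ((t * ∫ x, g n x ∂(φ : Measure ℝ) : ℝ) : ℂ) * Complex.I := fun n φ => by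
    simp only [hfr]
    rw [integral_mul_const, integral_complex_ofReal, integral_const_mul]
  have hcont : Continuous fun y : ℝ => ((t * y : ℝ) : ℂ) * Complex.I := by fun_prop
  have h1 := tendsto_integral_log_one_add hα (f := fun n x => f n x)
    (g := fun x => ((t * x : ℝ) : ℂ) * Complex.I) (r := 2 * |t|) (by positivity)
    (fun n => (f n).measurable) (fun n x => (hre0 _).ge) (fun x => (hre0 _).ge)
    (fun n x => by
      rw [hfr, norm_mul, Complex.norm_I, mul_one, Complex.norm_real, norm_mul, Real.norm_eq_abs t]
      have := mul_le_mul_of_nonneg_left (hle n x) (abs_nonneg t)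
      linarith)
    (fun x => (hcont.tendsto x).comp (hlim x))
  refine tendsto_nhds_unique ?_ ((Complex.continuous_exp.tendsto _).comp h1.neg)
  have h2 : ∀ n, (Complex.exp ∘ fun n => -∫ x, Complex.log (1 + f n x) ∂α) n =
      ∫ p, Complex.exp (-(p.1 * ∫ x, f n x ∂(p.2 : Measure ℝ))) ∂((gammaLaw a).prod D) := fun n =>
    (integral_exp_mul_integral_simpleFunc ha hα.1 hD (f n) (fun x => (hre0 _).ge)).symm
  rw [tendsto_congr h2]
  -- Convergence of the integrals to the mean needs a finite first moment, which holds almost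
  -- surely.
  have hsnd : ∀ᵐ p ∂(gammaLaw a).prod D, Integrable (fun x : ℝ => x) (p.2 : Measure ℝ) := by
    refine ae_of_ae_map (f := Prod.snd)
      (p := fun φ : ProbabilityMeasure ℝ => Integrable (fun x : ℝ => x) (φ : Measure ℝ))
      measurable_snd.aemeasurable ?_
    rw [Measure.map_snd_prod, measure_univ, one_smul]
    exact ae_integrable_id ha hα hD
  refine tendsto_integral_of_dominated_convergence (fun _ => (1 : ℝ))
    (fun n => (measurable_exp_neg_mul_integral_simpleFunc (f n)).aestronglyMeasurable)
    (integrable_const _) (fun n => ?_) ?_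
  · filter_upwards [ae_prod_pos (D := D) ha] with p hp
    refine norm_exp_neg_mul_le_one hp.le ?_
    rw [hint]
    exact (hre0 _).ge
  · filter_upwards [hsnd] with p hp
    have h3 := (hcont.tendsto _).comp (tendsto_integral_simpleFunc_mean hle hlim hp)
    refine ((Complex.continuous_exp.tendsto _).comp ((h3.const_mul (p.1 : ℂ)).neg)).congr
      fun n => ?_
    simp only [Function.comp, hint]

theorem isNegInvariant_of_charFun_neg {μ : Measure ℝ} [IsFiniteMeasure μ]
    (h : ∀ t, charFun μ (-t) = charFun μ t) : μ.IsNegInvariant := by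
  refine ⟨?_⟩
  have : IsFiniteMeasure μ.neg := by
    unfold Measure.neg
    infer_instance
  refine Measure.ext_of_charFun (funext fun t => ?_)
  rw [← h t, Measure.neg, charFun_apply_real, charFun_apply_real,
    integral_map measurable_neg.aemeasurable (by fun_prop)]
  simp

/-! ### Symmetric parameter implies symmetric mean -/

section Converse

theorem isNegInvariant_meanLaw (ha : 0 < a) (hα : α ∈ logFiniteMeasures a)
    (hD : IsDirichletLaw α D) (hinv : α.IsNegInvariant) : (meanLaw D).IsNegInvariant := by
  have hDp := hD.1
  have := isFiniteMeasure_of_mem_logFiniteMeasures hα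
  have : IsProbabilityMeasure (meanLaw D) :=
    Measure.isProbabilityMeasure_map measurable_mean.aemeasurable
  refine isNegInvariant_of_charFun_neg fun t => ?_
  obtain ⟨g, hle, hlim⟩ := exists_simpleFunc_approx_id
  set f : ℕ → SimpleFunc ℝ ℂ := fun n => (g n).map fun y : ℝ => (y : ℂ) with hf
  have hfr : ∀ n x, f n x = (g n x : ℂ) := fun n x => rfl
  have hint : ∀ n (φ : ProbabilityMeasure ℝ), ∫ x, f n x ∂(φ : Measure ℝ) =
      ((∫ x, g n x ∂(φ : Measure ℝ) : ℝ) : ℂ) := fun n φ => by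
    simp only [hfr]
    rw [integral_complex_ofReal]
  -- The functions `x ↦ -g n (-x)` also approximate the identity, so the integrals of the reflected
  -- `f n` tend to minus the mean.
  set g' : ℕ → SimpleFunc ℝ ℝ := fun n => ((g n).comp Neg.neg measurable_neg).map Neg.neg with hg'
  have hgr : ∀ n x, g' n x = -g n (-x) := fun n x => rfl
  have hint' : ∀ n (φ : ProbabilityMeasure ℝ), ∫ x, f n (-x) ∂(φ : Measure ℝ) =
      ((-∫ x, g' n x ∂(φ : Measure ℝ) : ℝ) : ℂ) := fun n φ => by
    simp only [hfr, hgr]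
    rw [integral_complex_ofReal, integral_neg, neg_neg]
  have hle' : ∀ n x, ‖g' n x‖ ≤ 2 * |x| := fun n x => by
    rw [hgr, norm_neg, ← abs_neg x]
    exact hle n (-x)
  have hlim' : ∀ x, Tendsto (fun n => g' n x) atTop (𝓝 x) := fun x => by
    simpa [hgr] using (hlim (-x)).neg
  -- Taking the real part keeps `F` bounded by `1` on all of `ℂ`; at real arguments it is the
  -- character defining `charFun`.
  set F : ℂ → ℂ := fun z => Complex.exp (t * z.re * Complex.I) with hF
  have hFc : Continuous F := by fun_prop
  have hFle : ∀ z, ‖F z‖ ≤ 1 := fun z => by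
    rw [hF]
    simp only [← Complex.ofReal_mul]
    rw [Complex.norm_exp_ofReal_mul_I]
  have hae := ae_integrable_id ha hα hD
  have hmeas' : ∀ n, Measurable fun φ : ProbabilityMeasure ℝ =>
      ∫ x, f n (-x) ∂(φ : Measure ℝ) := fun n =>
    measurable_integral_simpleFunc ((f n).comp Neg.neg measurable_neg)
  have h1 : Tendsto (fun n => ∫ φ : ProbabilityMeasure ℝ, F (∫ x, f n x ∂(φ : Measure ℝ)) ∂D) atTop
      (𝓝 (∫ φ : ProbabilityMeasure ℝ, F (mean φ) ∂D)) := by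
    refine tendsto_integral_of_dominated_convergence (fun _ => (1 : ℝ))
      (fun n => (hFc.measurable.comp (measurable_integral_simpleFunc (f n))).aestronglyMeasurable)
      (integrable_const _) (fun n => ae_of_all _ fun φ => hFle _) ?_
    filter_upwards [hae] with φ hφ
    simp only [hint]
    exact (hFc.tendsto _).comp ((Complex.continuous_ofReal.tendsto _).comp
      (tendsto_integral_simpleFunc_mean hle hlim hφ))
  have h2 : Tendsto (fun n => ∫ φ : ProbabilityMeasure ℝ, F (∫ x, f n (-x) ∂(φ : Measure ℝ)) ∂D)
      atTop (𝓝 (∫ φ : ProbabilityMeasure ℝ, F ((-mean φ : ℝ) : ℂ) ∂D)) := by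
    refine tendsto_integral_of_dominated_convergence (fun _ => (1 : ℝ))
      (fun n => (hFc.measurable.comp (hmeas' n)).aestronglyMeasurable)
      (integrable_const _) (fun n => ae_of_all _ fun φ => hFle _) ?_
    filter_upwards [hae] with φ hφ
    simp only [hint']
    exact (hFc.tendsto _).comp ((Complex.continuous_ofReal.tendsto _).comp
      (tendsto_integral_simpleFunc_mean hle' hlim' hφ).neg)
  simp only [fun n => integral_comp_integral_simpleFunc_neg hD (f n) hFc.measurable] at h2
  have h3 := tendsto_nhds_unique h1 h2
  simp only [meanLaw, charFun_apply_real]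
  rw [integral_map measurable_mean.aemeasurable (by fun_prop),
    integral_map measurable_mean.aemeasurable (by fun_prop)]
  simp only [hF, Complex.ofReal_re] at h3
  rw [h3]
  simp

end Converse

/-! ### Symmetric mean implies symmetric parameter -/

section Direct

/-- A bounded continuous function with vanishing Laplace transform is zero. -/
theorem eq_zero_of_laplace_eq_zero {S : ℝ → ℝ} {M : ℝ} (hS : Continuous S) (hM : ∀ u, |S u| ≤ M)
    (h : ∀ s > 0, ∫ u in Set.Ioi 0, Real.exp (-s * u) * S u = 0) :
    ∀ u > 0, S u = 0 := by
  set κ : Measure ℝ := volume.restrict (Set.Ioi 0) with hκ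
  have hexp : ∀ s > 0, Integrable (fun u => Real.exp (-s * u)) κ := fun s hs =>
    integrableOn_exp_mul_Ioi (by linarith) 0
  have hintS : ∀ s > 0, Integrable (fun u => Real.exp (-s * u) * S u) κ := fun s hs =>
    (hexp s hs).mul_bdd (c := M) hS.aestronglyMeasurable (ae_of_all _ hM)
  have hfun : ∀ (s : ℝ) (S' : ℝ → ℝ) u, Real.exp (-s * u) * (S' u + M) =
      Real.exp (-s * u) * S' u + Real.exp (-s * u) * M := fun s S' u => by ring
  have hnn : ∀ u, 0 ≤ S u + M := fun u => by linarith [neg_le_of_abs_le (hM u)]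
  have hM0 : 0 ≤ M := (abs_nonneg _).trans (hM 0)
  -- Adding `M` makes the density nonnegative and the factor `exp (-u)` makes it integrable. The
  -- hypothesis then says that `d` and `d'` define measures with equal Laplace transforms.
  set d : ℝ → ℝ≥0∞ := fun u => ENNReal.ofReal (Real.exp (-1 * u) * (S u + M)) with hd
  set d' : ℝ → ℝ≥0∞ := fun u => ENNReal.ofReal (Real.exp (-1 * u) * M) with hd'
  have hdm : Measurable d := by fun_prop
  have hdm' : Measurable d' := by fun_prop
  have hL : ∀ t < 1, ∫⁻ x, ENNReal.ofReal (Real.exp (t * x)) ∂κ.withDensity d =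
      ENNReal.ofReal (∫ u, Real.exp (-(1 - t) * u) * M ∂κ) := fun t ht => by
    rw [lintegral_withDensity_eq_lintegral_mul _ hdm (by fun_prop)]
    have h1 : ∫ u, Real.exp (-(1 - t) * u) * M ∂κ =
        ∫ u, Real.exp (-(1 - t) * u) * (S u + M) ∂κ := by
      simp_rw [hfun]
      rw [integral_add (hintS _ (by linarith)) ((hexp _ (by linarith)).mul_const _),
        h _ (by linarith), zero_add]
    rw [h1, ofReal_integral_eq_lintegral_ofReal]
    · refine lintegral_congr fun u => ?_
      simp only [hd, Pi.mul_apply]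
      rw [← ENNReal.ofReal_mul (mul_nonneg (Real.exp_pos _).le (hnn u)), mul_right_comm,
        ← Real.exp_add]
      ring_nf
    · simp_rw [hfun]
      exact (hintS _ (by linarith)).add ((hexp _ (by linarith)).mul_const _)
    · exact ae_of_all _ fun u => mul_nonneg (Real.exp_pos _).le (hnn u)
  have hL' : ∀ t < 1, ∫⁻ x, ENNReal.ofReal (Real.exp (t * x)) ∂κ.withDensity d' =
      ENNReal.ofReal (∫ u, Real.exp (-(1 - t) * u) * M ∂κ) := fun t ht => by
    rw [lintegral_withDensity_eq_lintegral_mul _ hdm' (by fun_prop),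
      ofReal_integral_eq_lintegral_ofReal ((hexp _ (by linarith)).mul_const _)
      (ae_of_all _ fun u => mul_nonneg (Real.exp_pos _).le hM0)]
    refine lintegral_congr fun u => ?_
    simp only [hd', Pi.mul_apply]
    rw [← ENNReal.ofReal_mul (mul_nonneg (Real.exp_pos _).le hM0), mul_right_comm,
      ← Real.exp_add]
    ring_nf
  have hfin : ∫⁻ u, d u ∂κ ≠ ⊤ := by
    have := hL 0 one_pos
    simp only [zero_mul, Real.exp_zero, ENNReal.ofReal_one, lintegral_one,
      withDensity_apply _ MeasurableSet.univ, Measure.restrict_univ] at this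
    rw [this]
    exact ENNReal.ofReal_ne_top
  have hfin' : ∫⁻ u, d' u ∂κ ≠ ⊤ := by
    have := hL' 0 one_pos
    simp only [zero_mul, Real.exp_zero, ENNReal.ofReal_one, lintegral_one,
      withDensity_apply _ MeasurableSet.univ, Measure.restrict_univ] at this
    rw [this]
    exact ENNReal.ofReal_ne_top
  have : IsFiniteMeasure (κ.withDensity d) := isFiniteMeasure_withDensity hfin
  have : IsFiniteMeasure (κ.withDensity d') := isFiniteMeasure_withDensity hfin'
  have heq : κ.withDensity d = κ.withDensity d' :=
    ext_of_lintegral_exp (fun t ht => by rw [hL t ht]; exact ENNReal.ofReal_ne_top)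
      (fun t ht => by rw [hL t ht, hL' t ht])
  have hae := (withDensity_eq_iff hdm.aemeasurable hdm'.aemeasurable hfin).1 heq
  have hS0 : S =ᵐ[κ] fun _ => 0 := by
    filter_upwards [hae] with u hu
    rw [ENNReal.ofReal_eq_ofReal_iff (mul_nonneg (Real.exp_pos _).le (hnn u))
      (mul_nonneg (Real.exp_pos _).le hM0)] at hu
    have := mul_left_cancel₀ (Real.exp_pos _).ne' hu
    linarith
  exact fun u hu => Measure.eqOn_open_of_ae_eq hS0 isOpen_Ioi hS.continuousOn continuousOn_const hu

/-- This is the imaginary part of `∫ exp ((-s + i x) u) du = 1 / (s - i x)`. -/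
theorem integral_exp_neg_mul_sin {s : ℝ} (hs : 0 < s) (x : ℝ) :
    ∫ u in Set.Ioi 0, Real.exp (-s * u) * Real.sin (u * x) = x / (s ^ 2 + x ^ 2) := by
  have hre : (-(s : ℂ) + x * Complex.I).re < 0 := by simpa using hs
  have h1 := integral_exp_mul_complex_Ioi hre 0
  have h2 := congrArg Complex.im h1
  have hi : Integrable (fun u : ℝ => Complex.exp ((-(s : ℂ) + x * Complex.I) * u))
      (volume.restrict (Set.Ioi 0)) := integrableOn_exp_mul_complex_Ioi hre 0
  have h3 := integral_im hi
  simp only [RCLike.im_to_complex] at h3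
  rw [← h3] at h2
  have h4 : ∀ u : ℝ, (Complex.exp ((-(s : ℂ) + x * Complex.I) * u)).im =
      Real.exp (-s * u) * Real.sin (u * x) := fun u => by
    rw [Complex.exp_im]
    simp [mul_comm]
  simp only [h4] at h2
  rw [h2]
  simp [Complex.div_im, Complex.normSq_apply]
  ring

/-- By Fubini the hypothesis says that `u ↦ ∫ sin (u x) dα`, the imaginary part of the
characteristic function, has zero Laplace transform. It therefore vanishes for `u > 0`, and
everywhere because it is odd. -/
theorem isNegInvariant_of_integral_eq_zero [IsFiniteMeasure α]
    (h : ∀ s > 0, ∫ x, x / (s ^ 2 + x ^ 2) ∂α = 0) : α.IsNegInvariant := by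
  set S : ℝ → ℝ := fun u => ∫ x, Real.sin (u * x) ∂α with hSdef
  have hS : Continuous S := by
    refine continuous_of_dominated (bound := fun _ => 1) (fun u => by fun_prop)
      (fun u => ae_of_all _ fun x => Real.abs_sin_le_one _) (integrable_const _)
      (ae_of_all _ fun x => by fun_prop)
  have hbound : ∀ u, |S u| ≤ α.real Set.univ := fun u => by
    have := norm_integral_le_of_norm_le_const (μ := α) (C := 1) (f := fun x => Real.sin (u * x))
      (ae_of_all _ fun x => Real.abs_sin_le_one _)
    simpa using this
  have hlap : ∀ s > 0, ∫ u in Set.Ioi 0, Real.exp (-s * u) * S u = 0 := fun s hs => by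
    refine Eq.trans ?_ (h s hs)
    simp only [hSdef, ← integral_const_mul]
    rw [integral_integral_swap]
    · simp_rw [integral_exp_neg_mul_sin hs]
    · have h1 : Integrable (fun p : ℝ × ℝ => Real.exp (-s * p.1))
          ((volume.restrict (Set.Ioi 0)).prod α) :=
        Integrable.comp_fst (integrableOn_exp_mul_Ioi (by linarith) 0) α
      exact h1.mul_bdd (c := 1) (Measurable.aestronglyMeasurable (by fun_prop))
        (ae_of_all _ fun p => Real.abs_sin_le_one _)
  have hzero := eq_zero_of_laplace_eq_zero hS hbound hlap
  have hodd : ∀ u, S (-u) = -S u := fun u => by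
    simp only [hSdef, neg_mul, Real.sin_neg, integral_neg]
  have hzero' : ∀ u, S u = 0 := fun u => by
    rcases lt_trichotomy u 0 with hu | rfl | hu
    · have := hzero (-u) (by linarith)
      rw [hodd] at this
      linarith
    · simp [hSdef]
    · exact hzero u hu
  refine isNegInvariant_of_charFun_neg fun t => ?_
  have him : ∀ t, (charFun α t).im = 0 := fun t => by
    have hi : Integrable (fun x : ℝ => Complex.exp (t * x * Complex.I)) α :=
      (integrable_const (1 : ℝ)).mono' (by fun_prop) (ae_of_all _ fun x => by
        rw [← Complex.ofReal_mul, Complex.norm_exp_ofReal_mul_I])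
    have h3 := integral_im hi
    simp only [RCLike.im_to_complex] at h3
    rw [charFun_apply_real, ← h3, ← hzero' t]
    refine integral_congr_ae (ae_of_all _ fun x => ?_)
    simp only [← Complex.ofReal_mul]
    rw [Complex.exp_ofReal_mul_I_im]
  rw [charFun_neg]
  exact Complex.conj_eq_iff_im.2 (him t)

theorem hasDerivAt_log_one_add_mul_I (x t : ℝ) :
    HasDerivAt (fun t : ℝ => Complex.log (1 + ((t * x : ℝ) : ℂ) * Complex.I))
      (x * Complex.I / (1 + ((t * x : ℝ) : ℂ) * Complex.I)) t := by
  have h1 : HasDerivAt (fun t : ℝ => 1 + ((t * x : ℝ) : ℂ) * Complex.I) (x * Complex.I) t := by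
    have h2 : HasDerivAt (fun t : ℝ => ((t * x : ℝ) : ℂ)) ((1 * x : ℝ) : ℂ) t :=
      ((hasDerivAt_id t).mul_const x).ofReal_comp
    simpa using (h2.mul_const Complex.I).const_add 1
  exact h1.clog_real (one_add_mem_slitPlane (by simp))

theorem deriv_log_sub_log (x t : ℝ) :
    x * Complex.I / (1 + ((t * x : ℝ) : ℂ) * Complex.I) -
      ((-x : ℝ) : ℂ) * Complex.I / (1 + ((t * -x : ℝ) : ℂ) * Complex.I) =
      ((2 * (x / (1 + (t * x) ^ 2)) : ℝ) : ℂ) * Complex.I := by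
  have h1 : (1 + ((t * x : ℝ) : ℂ) * Complex.I) ≠ 0 :=
    Complex.slitPlane_ne_zero (one_add_mem_slitPlane (by simp))
  have h2 : (1 + ((t * -x : ℝ) : ℂ) * Complex.I) ≠ 0 :=
    Complex.slitPlane_ne_zero (one_add_mem_slitPlane (by simp))
  have h3 : (1 + ((t * x : ℝ) : ℂ) * Complex.I) * (1 + ((t * -x : ℝ) : ℂ) * Complex.I) =
      ((1 + (t * x) ^ 2 : ℝ) : ℂ) := by
    push_cast
    linear_combination (-((t : ℂ) * x) ^ 2) * Complex.I_sq
  have h4 : ((1 + (t * x) ^ 2 : ℝ) : ℂ) ≠ 0 := h3 ▸ mul_ne_zero h1 h2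
  have h5 : ((2 * (x / (1 + (t * x) ^ 2)) : ℝ) : ℂ) * ((1 + (t * x) ^ 2 : ℝ) : ℂ) =
      ((2 * x : ℝ) : ℂ) := by
    rw [← Complex.ofReal_mul]
    congr 1
    have : 1 + (t * x) ^ 2 ≠ 0 := by positivity
    field_simp
  rw [div_sub_div _ _ h1 h2, h3, div_eq_iff h4,
    mul_right_comm (Complex.ofReal _) _ (Complex.ofReal _), h5]
  push_cast
  ring

/-- If `∫ log (1 + i t x) dα` is even in `t` up to multiples of `2 π i`, then `α` is symmetric. -/
theorem isNegInvariant_of_exp_integral_log_eq (hα : α ∈ logFiniteMeasures a)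
    (h : ∀ t : ℝ, Complex.exp (-∫ x, Complex.log (1 + ((t * x : ℝ) : ℂ) * Complex.I) ∂α) =
      Complex.exp (-∫ x, Complex.log (1 + ((-t * x : ℝ) : ℂ) * Complex.I) ∂α)) :
    α.IsNegInvariant := by
  have hfin := isFiniteMeasure_of_mem_logFiniteMeasures hα
  set ℓ : ℝ → ℝ → ℂ := fun t x => Complex.log (1 + ((t * x : ℝ) : ℂ) * Complex.I) with hℓ
  have hint : ∀ t, Integrable (ℓ t) α := fun t =>
    (integrable_log_bound hα |t|).mono' (Measurable.aestronglyMeasurable (by fun_prop))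
      (ae_of_all _ fun x => norm_log_one_add_le (by simp) (abs_nonneg t) (by
        rw [norm_mul, Complex.norm_I, mul_one, Complex.norm_real, norm_mul]
        rfl))
  set G : ℝ → ℂ := fun t => ∫ x, (ℓ t x - ℓ t (-x)) ∂α with hG
  have hneg : ∀ t x, ℓ t (-x) = ℓ (-t) x := fun t x => by simp [hℓ]
  have hexpG : ∀ t, Complex.exp (G t) = 1 := fun t => by
    simp only [hG, hneg]
    rw [integral_sub (hint t) (hint (-t)), sub_eq_neg_add, Complex.exp_add, ← h t,
      ← Complex.exp_add, neg_add_cancel, Complex.exp_zero]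
  refine isNegInvariant_of_integral_eq_zero fun s hs => ?_
  -- With this choice `x / (1 + (t₀ x)²) = s² x / (s² + x²)`.
  set t₀ : ℝ := 1 / s with ht₀
  have ht₀pos : 0 < t₀ := by positivity
  have hderiv : HasDerivAt G
      (∫ x, ((2 * (x / (1 + (t₀ * x) ^ 2)) : ℝ) : ℂ) * Complex.I ∂α) t₀ := by
    refine (hasDerivAt_integral_of_dominated_loc_of_deriv_le (μ := α)
      (F := fun t x => ℓ t x - ℓ t (-x))
      (F' := fun t x => ((2 * (x / (1 + (t * x) ^ 2)) : ℝ) : ℂ) * Complex.I)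
      (bound := fun _ => 2 / t₀) (s := Set.Ioi (t₀ / 2)) (Ioi_mem_nhds (by linarith))
      (Eventually.of_forall fun t => Measurable.aestronglyMeasurable (by fun_prop)) ?_
      (Measurable.aestronglyMeasurable (by fun_prop)) ?_ (integrable_const _) ?_).2
    · simp only [hneg]
      exact (hint t₀).sub (hint (-t₀))
    · refine ae_of_all _ fun x t ht => ?_
      have htp : 0 < t := (half_pos ht₀pos).trans ht
      rw [norm_mul, Complex.norm_I, mul_one, Complex.norm_real, Real.norm_eq_abs, abs_mul, abs_div,
        abs_of_pos (by positivity : 0 < 1 + (t * x) ^ 2), abs_two]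
      -- For `t > t₀ / 2`, `t₀ |x| ≤ 2 t |x| ≤ 1 + (t x)²`.
      have h1 : |x| / (1 + (t * x) ^ 2) ≤ 1 / t₀ := by
        rw [div_le_div_iff₀ (by positivity) ht₀pos]
        have h2 : t₀ * |x| ≤ 2 * (t * |x|) := by
          have ht' : t₀ / 2 < t := ht
          nlinarith [abs_nonneg x]
        have h3 : 2 * (t * |x|) ≤ 1 + (t * x) ^ 2 := by
          rw [mul_pow, ← sq_abs x]
          nlinarith [sq_nonneg (t * |x| - 1)]
        linarith
      calc 2 * (|x| / (1 + (t * x) ^ 2)) ≤ 2 * (1 / t₀) := by gcongr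
        _ = 2 / t₀ := by ring
    · refine ae_of_all _ fun x t _ => ?_
      rw [← deriv_log_sub_log]
      exact (hasDerivAt_log_one_add_mul_I x t).sub (hasDerivAt_log_one_add_mul_I (-x) t)
  -- A priori `G` is only known modulo `2 π i`; differentiating `exp (G t) = 1` gives `G' = 0`
  -- without choosing a branch.
  have h1 : HasDerivAt (fun t => Complex.exp (G t)) _ t₀ := hderiv.cexp
  have h2 : (fun t => Complex.exp (G t)) = fun _ => 1 := funext hexpG
  rw [h2] at h1
  have h3 := h1.unique (hasDerivAt_const t₀ 1)
  rw [hexpG, one_mul, integral_mul_const, mul_eq_zero, or_iff_left Complex.I_ne_zero,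
    integral_complex_ofReal, Complex.ofReal_eq_zero, integral_const_mul, mul_eq_zero,
    or_iff_right two_ne_zero] at h3
  have h4 : ∀ x : ℝ, x / (s ^ 2 + x ^ 2) = (1 / s ^ 2) * (x / (1 + (t₀ * x) ^ 2)) := fun x => by
    have : s ^ 2 + x ^ 2 ≠ 0 := by positivity
    rw [ht₀]
    field_simp
  simp_rw [h4]
  rw [integral_const_mul, h3, mul_zero]

theorem isNegInvariant_of_meanLaw (ha : 0 < a) (hα : α ∈ logFiniteMeasures a)
    (hD : IsDirichletLaw α D) (hinv : (meanLaw D).IsNegInvariant) : α.IsNegInvariant := by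
  have hDp := hD.1
  refine isNegInvariant_of_exp_integral_log_eq hα fun t => ?_
  rw [← integral_exp_I_mul_mean ha hα hD, ← integral_exp_I_mul_mean ha hα hD]
  have hm := measurable_mean
  have hi : ∀ t : ℝ, Integrable (fun p : ℝ × ProbabilityMeasure ℝ =>
      Complex.exp (-(p.1 * (((t * mean p.2 : ℝ) : ℂ) * Complex.I)))) ((gammaLaw a).prod D) :=
    fun t => by
      refine (integrable_const (1 : ℝ)).mono' (Measurable.aestronglyMeasurable (by fun_prop)) ?_
      filter_upwards [ae_prod_pos (D := D) ha] with p hp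
      exact norm_exp_neg_mul_le_one hp.le (by simp)
  -- For a fixed value `s` of the gamma variable, the inner integral depends only on the law of the
  -- mean, whose symmetry exchanges `t` and `-t`.
  rw [integral_prod _ (hi t), integral_prod _ (hi (-t))]
  refine integral_congr_ae (ae_of_all _ fun s => ?_)
  have hlaw : ∀ t : ℝ, ∫ φ, Complex.exp (-(s * (((t * mean φ : ℝ) : ℂ) * Complex.I))) ∂D =
      ∫ m, Complex.exp (-(s * (((t * m : ℝ) : ℂ) * Complex.I))) ∂meanLaw D := fun t => by
    rw [meanLaw, integral_map hm.aemeasurable (by fun_prop)]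
  simp only [hlaw]
  rw [← integral_neg_eq_self]
  simp

end Direct

end DirichletProcess

theorem theorem8 (a : ℝ) (ha : 0 < a) (α : Measure ℝ)
    (hα : α ∈ DirichletProcess.logFiniteMeasures a)
    (D : Measure (ProbabilityMeasure ℝ)) (hD : DirichletProcess.IsDirichletLaw α D) :
    (∀ᵐ φ : ProbabilityMeasure ℝ ∂D, Integrable (fun x : ℝ => x) (φ : Measure ℝ)) ∧
      ((DirichletProcess.meanLaw D).IsNegInvariant ↔ α.IsNegInvariant) :=
  ⟨DirichletProcess.ae_integrable_id ha hα hD,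
    DirichletProcess.isNegInvariant_of_meanLaw ha hα hD,
    DirichletProcess.isNegInvariant_meanLaw ha hα hD⟩
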